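/- Let $K$ be an arbitrary field. For a field extension $L/K$ and an intermediate field $K\subset L_0\subset L$ with $L/L_0$ finite separable, say that $L/L_0$ is *defined over* $E_0$ if $K\subset E_0\subset L_0$ and there is a field $E$ with $E_0\subset E\subset L$, $[E:E_0]=[L:L_0]$ and $L=EL_0$; the *essential dimension* $\mathrm{ed}_K(L/L_0)\in\mathbb{N}\cup\{\infty\}$ is the minimum of $\mathrm{trdeg}_K E_0$ over all $E_0$ over which $L/L_0$ is defined. Let $G$ be a finite group. A *faithful $G$-field* over $K$ is a field extension $L/K$ with an injective group homomorphism $G\to\mathrm{Aut}_K(L)$; $L^G$ denotes its fixed field. For a faithful finite-dimensional representation $G\to GL(V)$ over $K$, let $K(V)$ be the function field of the affine space $V$, i.e. the fraction field of the symmetric algebra of $V^*$, with the induced action of $G$, and put $\mathrm{ed}_K(G)=\mathrm{ed}_K(K(V)/K(V)^G)$. **Proposition 2.8.** For every faithful $G$-field $L$ over $K$, and whichever faithful finite-dimensional representation $V$ of $G$ over $K$ is used to define $\mathrm{ed}_K(G)$, $$\mathrm{ed}_K(L/L^G)\le \mathrm{ed}_K(G).$$ -/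

import Mathlib

noncomputable section

namespace EssentialDimension

open IntermediateField

section Fields

variable {K L : Type*} [Field K] [Field L] [Algebra K L]

/-- `L / L₀` is defined over the subextension `E / E₀`. All fields are intermediate fields of
`L / K`, with `E₀ ⊆ E`, `E₀ ⊆ L₀`, `[E : E₀] = [L : L₀]` and `L = E L₀`.
(As `E₀ ≤ E`, `relfinrank E₀ E` is the degree `[E : E₀]`.) -/
def IsDefinedOver (L₀ E E₀ : IntermediateField K L) : Prop :=
  E₀ ≤ E ∧ E₀ ≤ L₀ ∧ relfinrank E₀ E = Module.finrank L₀ L ∧ E ⊔ L₀ = ⊤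

/-- The essential dimension `ed_K(L / L₀)` of a finite separable extension `L / L₀` of fields
containing `K`: the minimum of `trdeg_K E₀` over all `E₀` over which `L / L₀` is defined.
Transcendence degrees are natural numbers or `∞`; the set below is nonempty for every `L₀`
(it contains `trdeg_K L₀`, with `E = L`, `E₀ = L₀`), so its infimum in `ℕ∞` is a minimum. -/
def essDim (L₀ : IntermediateField K L) : ℕ∞ :=
  sInf {d : ℕ∞ | ∃ E E₀ : IntermediateField K L,
    IsDefinedOver L₀ E E₀ ∧ d = Cardinal.toENat (Algebra.trdeg K E₀)}

/-- The fixed field `L^G` of a `G`-field `L` over `K`, that is, of a field extension `L` of `K`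
with a group homomorphism `φ : G → Aut_K(L)`. -/
def fixedSubfield {G : Type*} [Group G] (φ : G →* (L ≃ₐ[K] L)) : IntermediateField K L :=
  IntermediateField.fixedField φ.range

end Fields

section Representations

variable {K G V : Type*} [Field K] [Group G] [AddCommGroup V] [Module K V]

variable (K V) in
/-- The coordinate ring `K[V]` of the affine space `V`: the symmetric algebra of the dual space,
a polynomial ring in a basis of `V*` when `V` is finite-dimensional. -/
abbrev CoordinateRing : Type _ := SymmetricAlgebra K (Module.Dual K V)

variable (K V) in
/-- The function field `K(V)` of the affine space `V`. -/
abbrev FunctionField : Type _ := FractionRing (CoordinateRing K V)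

/-- The endomorphism of `K[V]` extending `f ↦ f ∘ ρ(σ⁻¹)` on `V*`. -/
def coordinateMap (ρ : Representation K G V) (σ : G) :
    CoordinateRing K V →ₐ[K] CoordinateRing K V :=
  SymmetricAlgebra.lift (SymmetricAlgebra.ι K (Module.Dual K V) ∘ₗ ρ.dual σ)

theorem coordinateMap_ι (ρ : Representation K G V) (σ : G) (f : Module.Dual K V) :
    coordinateMap ρ σ (SymmetricAlgebra.ι K _ f) = SymmetricAlgebra.ι K _ (ρ.dual σ f) :=
  SymmetricAlgebra.lift_ι_apply _ f

theorem coordinateMap_one (ρ : Representation K G V) :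
    coordinateMap ρ 1 = AlgHom.id K (CoordinateRing K V) := by
  apply SymmetricAlgebra.algHom_ext
  refine LinearMap.ext fun f => ?_
  change coordinateMap ρ 1 (SymmetricAlgebra.ι K _ f) = SymmetricAlgebra.ι K _ f
  rw [coordinateMap_ι, map_one, Module.End.one_apply]

theorem coordinateMap_mul (ρ : Representation K G V) (σ τ : G) :
    coordinateMap ρ (σ * τ) = (coordinateMap ρ σ).comp (coordinateMap ρ τ) := by
  apply SymmetricAlgebra.algHom_ext
  refine LinearMap.ext fun f => ?_
  change coordinateMap ρ (σ * τ) (SymmetricAlgebra.ι K _ f) =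
    coordinateMap ρ σ (coordinateMap ρ τ (SymmetricAlgebra.ι K _ f))
  rw [coordinateMap_ι, coordinateMap_ι, coordinateMap_ι, map_mul, Module.End.mul_apply]

/-- The action of `G` on `K[V]` by `K`-algebra automorphisms. -/
def coordinateAction (ρ : Representation K G V) :
    G →* (CoordinateRing K V ≃ₐ[K] CoordinateRing K V) where
  toFun σ := AlgEquiv.ofAlgHom (coordinateMap ρ σ) (coordinateMap ρ σ⁻¹)
    (by rw [← coordinateMap_mul, mul_inv_cancel, coordinateMap_one])
    (by rw [← coordinateMap_mul, inv_mul_cancel, coordinateMap_one])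
  map_one' := AlgEquiv.ext fun x => DFunLike.congr_fun (coordinateMap_one ρ) x
  map_mul' σ τ := AlgEquiv.ext fun x => DFunLike.congr_fun (coordinateMap_mul ρ σ τ) x

/-- The action of `G` on `K(V)` by `K`-automorphisms. -/
def functionFieldAction (ρ : Representation K G V) :
    G →* (FunctionField K V ≃ₐ[K] FunctionField K V) :=
  (IsFractionRing.fieldEquivOfAlgEquivHom K (FunctionField K V)).comp (coordinateAction ρ)

/-- The essential dimension `ed_K(G) = ed_K(K(V) / K(V)^G)` of `G` over `K`, computed from the
finite-dimensional faithful representation `ρ : G → GL(V)`. -/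
def essDimGroup (ρ : Representation K G V) : ℕ∞ :=
  essDim (fixedSubfield (K := K) (L := FunctionField K V) (functionFieldAction ρ))

end Representations

end EssentialDimension

end

namespace EssentialDimension

open IntermediateField

/-! Essential dimension is controlled by `G`-stable subfields on which `G` acts faithfully. By
Artin's theorem `L / L^G` is defined over `F^G` for any such `F ⊆ L`. Conversely, if it is defined
over `E₀`, the relative algebraic closure of `E₀` in `L` is such an `F`, with the same transcendence
degree (`exists_stable_of_isDefinedOver`).

So take such an `F` in `K(V)` and push it into `L` by an equivariant homomorphism `ψ : K[V] → L`. It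
suffices that `ψ` be defined at some `y ∈ F` and at `(g y - y)⁻¹`, for each `g ≠ 1`: the unit `g y -
y` cannot go to `0`, so `G` acts faithfully on the field generated by the image
(`essDim_le_of_specialization`). These finitely many fractions have a common denominator `f`, and `ψ
f ≠ 0` can be achieved when `L^G` is infinite, since equivariant points are Zariski dense
(`exists_equivariant_lift_ne_zero`). If `L^G` is finite, so is `L`, and the left side is `0`. -/

theorem trdeg_eq_of_isAlgebraic.{u, v} (K : Type u) (E F : Type v) [Field K] [Field E] [Field F]
    [Algebra K E] [Algebra K F] [Algebra E F] [IsScalarTower K E F] [Algebra.IsAlgebraic E F] :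
    Algebra.trdeg K F = Algebra.trdeg K E := by
  rw [← trdeg_add_eq K E (A := F), trdeg_eq_zero (R := E), add_zero]

/-! ### Stable faithful subfields and essential dimension -/

section Galois

variable {K L G : Type*} [Field K] [Field L] [Algebra K L] [Group G]

theorem mem_fixedSubfield {φ : G →* (L ≃ₐ[K] L)} {x : L} :
    x ∈ fixedSubfield φ ↔ ∀ g, φ g x = x := by
  simp [fixedSubfield]

instance finite_range [Finite G] (φ : G →* (L ≃ₐ[K] L)) : Finite φ.range :=
  Finite.of_surjective _ φ.rangeRestrict_surjective

instance isGaloisGroup_range [Finite G] (φ : G →* (L ≃ₐ[K] L)) :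
    IsGaloisGroup φ.range (fixedSubfield φ) L :=
  IsGaloisGroup.fixedPoints φ.range L

instance finiteDimensional_fixedSubfield [Finite G] (φ : G →* (L ≃ₐ[K] L)) :
    FiniteDimensional (fixedSubfield φ) L :=
  IsGaloisGroup.finiteDimensional φ.range _ _

theorem finrank_fixedSubfield [Finite G] {φ : G →* (L ≃ₐ[K] L)} (hφ : Function.Injective φ) :
    Module.finrank (fixedSubfield φ) L = Nat.card G := by
  rw [← IsGaloisGroup.card_eq_finrank φ.range (fixedSubfield φ) L]
  exact Nat.card_congr (MonoidHom.ofInjective hφ).toEquiv.symm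

/-- A subextension containing `L^G` that is fixed pointwise by no nontrivial element of `G` is
everything. -/
theorem eq_top_of_faithful [Finite G] (φ : G →* (L ≃ₐ[K] L)) (M : IntermediateField K L)
    (hM : fixedSubfield φ ≤ M) (h : ∀ g : G, (∀ x ∈ M, φ g x = x) → φ g = 1) : M = ⊤ := by
  -- By the Galois correspondence `M` is the fixed field of its fixing subgroup, which is trivial.
  have hbot : fixingSubgroup φ.range ((extendScalars hM : IntermediateField _ L) : Set L) = ⊥ := by
    rw [eq_bot_iff]
    rintro ⟨_, g, rfl⟩ hg
    rw [mem_fixingSubgroup_iff] at hg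
    exact Subtype.ext (h g fun x hx => hg x hx)
  have h1 := IsGaloisGroup.fixedPoints_fixingSubgroup φ.range (fixedSubfield φ) L
    (extendScalars hM)
  rw [hbot, IsGaloisGroup.fixedPoints_bot] at h1
  rw [eq_top_iff]
  intro x _
  have : x ∈ (extendScalars hM : IntermediateField (fixedSubfield φ) L) := by
    rw [← h1]; trivial
  exact this

/-- The action of `G` on a `G`-stable subextension. -/
def restrictAction (φ : G →* (L ≃ₐ[K] L)) (F : IntermediateField K L)
    (hF : ∀ g, ∀ x ∈ F, φ g x ∈ F) : G →* (F ≃ₐ[K] F) where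
  toFun g := AlgEquiv.ofAlgHom
    (((φ g : L →ₐ[K] L).comp F.val).codRestrict F.toSubalgebra fun x => hF g x x.2)
    (((φ g⁻¹ : L →ₐ[K] L).comp F.val).codRestrict F.toSubalgebra fun x => hF g⁻¹ x x.2)
    (AlgHom.ext fun x => Subtype.ext (by
      change φ g (φ g⁻¹ x) = x
      rw [← AlgEquiv.mul_apply, ← map_mul, mul_inv_cancel, map_one, AlgEquiv.one_apply]))
    (AlgHom.ext fun x => Subtype.ext (by
      change φ g⁻¹ (φ g x) = x
      rw [← AlgEquiv.mul_apply, ← map_mul, inv_mul_cancel, map_one, AlgEquiv.one_apply]))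
  map_one' := AlgEquiv.ext fun x => Subtype.ext (by
    change φ 1 x = x
    rw [map_one, AlgEquiv.one_apply])
  map_mul' g h := AlgEquiv.ext fun x => Subtype.ext (by
    change φ (g * h) x = φ g (φ h x)
    rw [map_mul, AlgEquiv.mul_apply])

/-- `L / L^G` is defined over `F^G` for every `G`-stable subextension `F` on which `G` acts
faithfully. -/
theorem isDefinedOver_of_stable [Finite G] {φ : G →* (L ≃ₐ[K] L)} (hφ : Function.Injective φ)
    (F : IntermediateField K L) (hF : ∀ g, ∀ x ∈ F, φ g x ∈ F)
    (h : ∀ g : G, (∀ x ∈ F, φ g x = x) → g = 1) :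
    IsDefinedOver (fixedSubfield φ) F (fixedSubfield φ ⊓ F) := by
  refine ⟨inf_le_right, inf_le_left, ?_, ?_⟩
  -- Regard `F` as a faithful `G`-field in its own right: by Artin's theorem both degrees are the
  -- order of `G`.
  · let ψ := restrictAction φ F hF
    have hψ : Function.Injective ψ := by
      rw [injective_iff_map_eq_one]
      intro g hg
      exact h g fun x hx => congrArg Subtype.val (DFunLike.congr_fun hg (⟨x, hx⟩ : F))
    have h1 : fixedSubfield φ ⊓ F = (fixedSubfield ψ).map F.val := by
      ext x
      constructor
      · rintro ⟨hx, hxF⟩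
        refine ⟨⟨x, hxF⟩, ?_, rfl⟩
        exact mem_fixedSubfield.2 fun g => Subtype.ext (mem_fixedSubfield.1 hx g)
      · rintro ⟨y, hy, rfl⟩
        refine ⟨mem_fixedSubfield.2 fun g => ?_, y.2⟩
        exact congrArg Subtype.val (mem_fixedSubfield.1 hy g)
    have h2 : F = (⊤ : IntermediateField K F).map F.val := by
      rw [← AlgHom.fieldRange_eq_map, fieldRange_val]
    have h3 : relfinrank (fixedSubfield φ ⊓ F) F =
        relfinrank ((fixedSubfield ψ).map F.val) ((⊤ : IntermediateField K F).map F.val) := by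
      rw [← h1, ← h2]
    rw [h3, relfinrank_map_map, relfinrank_top_right, finrank_fixedSubfield hψ,
      finrank_fixedSubfield hφ]
  · refine eq_top_of_faithful φ _ le_sup_right fun g hg => ?_
    rw [h g fun x hx => hg x ((le_sup_left : F ≤ F ⊔ fixedSubfield φ) hx), map_one]

theorem trdeg_inf_fixedSubfield_le (φ : G →* (L ≃ₐ[K] L)) (F : IntermediateField K L) :
    Algebra.trdeg K (fixedSubfield φ ⊓ F : IntermediateField K L) ≤ Algebra.trdeg K F :=
  trdeg_le_of_injective (inclusion inf_le_right) (inclusion_injective inf_le_right)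

theorem essDim_le_trdeg_of_stable [Finite G] {φ : G →* (L ≃ₐ[K] L)} (hφ : Function.Injective φ)
    (F : IntermediateField K L) (hF : ∀ g, ∀ x ∈ F, φ g x ∈ F)
    (h : ∀ g : G, (∀ x ∈ F, φ g x = x) → g = 1) :
    essDim (fixedSubfield φ) ≤ Cardinal.toENat (Algebra.trdeg K F) :=
  have hle : essDim (fixedSubfield φ) ≤ Cardinal.toENat
      (Algebra.trdeg K (fixedSubfield φ ⊓ F : IntermediateField K L)) :=
    sInf_le ⟨F, fixedSubfield φ ⊓ F, isDefinedOver_of_stable hφ F hF h, rfl⟩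
  hle.trans (OrderHomClass.mono _ (trdeg_inf_fixedSubfield_le φ F))

/-- If `L / L^G` is defined over `E₀`, then the relative algebraic closure of `E₀` in `L` is a
`G`-stable subextension of the same transcendence degree on which `G` acts faithfully. -/
theorem exists_stable_of_isDefinedOver [Finite G] {φ : G →* (L ≃ₐ[K] L)} (hφ : Function.Injective φ)
    {E E₀ : IntermediateField K L} (hE : IsDefinedOver (fixedSubfield φ) E E₀) :
    ∃ F : IntermediateField K L, (∀ g, ∀ x ∈ F, φ g x ∈ F) ∧
      (∀ g : G, (∀ x ∈ F, φ g x = x) → g = 1) ∧ Algebra.trdeg K F = Algebra.trdeg K E₀ := by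
  obtain ⟨hle, hfix, hrank, hsup⟩ := hE
  have hcomm (g : G) (x : E₀) : φ g x = x := mem_fixedSubfield.1 (hfix x.2) g
  refine ⟨(algebraicClosure E₀ L).restrictScalars K, fun g x hx => ?_, fun g hg => ?_, ?_⟩
  -- Since `E₀ ⊆ L^G`, each `g` is `E₀`-linear and so preserves algebraicity over `E₀`.
  · let τ : L →ₐ[E₀] L := { (φ g : L →ₐ[K] L) with commutes' := hcomm g }
    exact (map_mem_algebraicClosure_iff τ).2 hx
  · have hEF : E ≤ (algebraicClosure E₀ L).restrictScalars K := by
      -- `relfinrank` is `0` in infinite degree, but here it equals the positive degree of `L /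
      -- L^G`.
      have : FiniteDimensional E₀ (extendScalars hle) := by
        apply Module.finite_of_finrank_pos
        rw [← relfinrank_eq_finrank_of_le, hrank]
        exact Module.finrank_pos
      intro x hx
      have := Algebra.IsAlgebraic.isAlgebraic (R := E₀) (⟨x, hx⟩ : extendScalars hle)
      exact mem_algebraicClosure_iff.2 (this.algHom (extendScalars hle).val)
    apply hφ
    rw [map_one]
    -- The fixed field of `g` contains both `E` and `L^G`, which together generate `L`.
    have h1 : fixedField (Subgroup.zpowers (φ g)) = ⊤ := by
      rw [eq_top_iff, ← hsup, sup_le_iff]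
      constructor
      · rw [le_iff_le, Subgroup.zpowers_le]
        intro x
        exact hg x (hEF x.2)
      · rw [le_iff_le, Subgroup.zpowers_le]
        intro x
        exact mem_fixedSubfield.1 x.2 g
    ext x
    have : x ∈ fixedField (Subgroup.zpowers (φ g)) := by rw [h1]; trivial
    exact (mem_fixedField_iff _ _).1 this _ (Subgroup.mem_zpowers _)
  · exact trdeg_eq_of_isAlgebraic K E₀ (algebraicClosure E₀ L)

/-- Here `L` is finite, hence algebraic over `K`, and `F = ⊤` gives the bound `0`. The density
argument needs `L^G` infinite. -/
theorem essDim_eq_zero_of_finite [Finite G] {φ : G →* (L ≃ₐ[K] L)} (hφ : Function.Injective φ)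
    [Finite (fixedSubfield φ)] : essDim (fixedSubfield φ) = 0 := by
  have : Finite L := Module.finite_of_finite (fixedSubfield φ)
  have : Algebra.trdeg K (⊤ : IntermediateField K L) = 0 := by
    have : Module.Finite K (⊤ : IntermediateField K L) := Module.Finite.of_finite
    exact trdeg_eq_zero
  have := essDim_le_trdeg_of_stable hφ ⊤ (fun _ _ _ => trivial)
    fun g hg => hφ (by ext x; simpa using hg x trivial)
  simp_all

end Galois

/-! ### Density of equivariant points -/

section Equivariant

variable {K L G W : Type*} [Field K] [Field L] [Algebra K L] [Group G]
  [AddCommGroup W] [Module K W]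

/-- Distinct automorphisms are separated by an `L`-linear combination of evaluations. -/
theorem exists_sum_mul_eq_single [Finite G] [DecidableEq G] {φ : G →* (L ≃ₐ[K] L)}
    (hφ : Function.Injective φ) :
    ∃ a : L →₀ L, ∀ g, (a.sum fun b c => c * φ g b) = if g = 1 then 1 else 0 := by
  have := Fintype.ofFinite G
  let v : L → G → L := fun b g => φ g b
  -- A nonzero linear form killing every `v b` would be a linear relation between distinct
  -- automorphisms, against Dedekind's independence of characters.
  have hspan : Submodule.span L (Set.range v) = ⊤ := by
    by_contra hne
    obtain ⟨f, hf0, hf⟩ := Submodule.exists_le_ker_of_lt_top _ (lt_top_iff_ne_top.2 hne)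
    have hli : LinearIndependent L (fun (g : G) (b : L) => φ g b) :=
      (linearIndependent_monoidHom L L).comp (fun g : G => ((φ g : L →+* L) : L →* L))
        fun g h hgh => hφ (AlgEquiv.ext fun x => DFunLike.congr_fun hgh x)
    have hzero := Fintype.linearIndependent_iff.1 hli (fun g => f (Pi.single g 1)) (by
      funext b
      have hb : f (v b) = 0 := hf (Submodule.subset_span ⟨b, rfl⟩)
      rw [LinearMap.pi_apply_eq_sum_univ f (v b)] at hb
      rw [Finset.sum_apply, Pi.zero_apply, ← hb]
      refine Finset.sum_congr rfl fun g _ => ?_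
      rw [Pi.smul_apply, smul_eq_mul, smul_eq_mul, mul_comm]
      congr 2
      ext h
      simp [Pi.single_apply, eq_comm])
    apply hf0
    refine LinearMap.pi_ext' fun g => LinearMap.ext_ring ?_
    exact hzero g
  have hmem : (Pi.single 1 1 : G → L) ∈ Submodule.span L (Set.range v) := hspan ▸ trivial
  obtain ⟨a, ha⟩ := Finsupp.mem_span_range_iff_exists_finsupp.1 hmem
  refine ⟨a, fun g => ?_⟩
  have := congrFun ha g
  rw [Finsupp.sum, Finset.sum_apply, Pi.single_apply] at this
  exact this

/-- The equivariant linear map obtained by averaging. -/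
def average [Fintype G] (φ : G →* (L ≃ₐ[K] L)) (τ : Representation K G W) (h : W →ₗ[K] L) :
    W →ₗ[K] L :=
  ∑ g, (φ g).toLinearMap ∘ₗ h ∘ₗ τ g⁻¹

theorem average_apply [Fintype G] (φ : G →* (L ≃ₐ[K] L)) (τ : Representation K G W)
    (h : W →ₗ[K] L) (w : W) : average φ τ h w = ∑ g, φ g (h (τ g⁻¹ w)) := by
  simp [average]

theorem average_equivariant [Fintype G] (φ : G →* (L ≃ₐ[K] L)) (τ : Representation K G W)
    (h : W →ₗ[K] L) (s : G) (w : W) : average φ τ h (τ s w) = φ s (average φ τ h w) := by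
  rw [average_apply, average_apply, map_sum]
  refine (Fintype.sum_equiv (Equiv.mulLeft s) _ _ fun g => ?_).symm
  rw [Equiv.coe_mulLeft, map_mul φ, AlgEquiv.mul_apply, mul_inv_rev, map_mul τ,
    Module.End.mul_apply, ← Module.End.mul_apply (τ s⁻¹), ← map_mul, inv_mul_cancel, map_one,
    Module.End.one_apply]

/-- Every linear map to `L` is an `L`-linear combination of equivariant ones. -/
theorem exists_sum_smul_equivariant [Finite G] {φ : G →* (L ≃ₐ[K] L)}
    (hφ : Function.Injective φ) (τ : Representation K G W) (h : W →ₗ[K] L) :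
    ∃ (s : Finset L) (a : L → L) (ψ : L → W →ₗ[K] L),
      (∀ b g w, ψ b (τ g w) = φ g (ψ b w)) ∧ ∀ w, h w = ∑ b ∈ s, a b * ψ b w := by
  classical
  have := Fintype.ofFinite G
  obtain ⟨a, ha⟩ := exists_sum_mul_eq_single hφ
  refine ⟨a.support, a, fun b => average φ τ (LinearMap.mulLeft K b ∘ₗ h),
    fun b g w => average_equivariant _ _ _ _ _, fun w => ?_⟩
  simp_rw [average_apply, Finset.mul_sum]
  rw [Finset.sum_comm]
  -- The choice of `a` kills every term of the averages except `g = 1`, which is `h w`.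
  have (g : G) : (∑ b ∈ a.support, a b * φ g ((LinearMap.mulLeft K b ∘ₗ h) (τ g⁻¹ w))) =
      (if g = 1 then 1 else 0) * φ g (h (τ g⁻¹ w)) := by
    rw [← ha g, Finsupp.sum, Finset.sum_mul]
    refine Finset.sum_congr rfl fun b _ => ?_
    rw [LinearMap.comp_apply, LinearMap.mulLeft_apply, map_mul, mul_assoc]
  simp_rw [this]
  simp

/-- A nonzero element of a symmetric algebra does not vanish at some point over any infinite
extension field. -/
theorem exists_lift_ne_zero [Infinite L] {f : SymmetricAlgebra K W} (hf : f ≠ 0) :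
    ∃ h : W →ₗ[K] L, SymmetricAlgebra.lift h f ≠ 0 := by
  let b := Module.Free.chooseBasis K W
  let e := SymmetricAlgebra.equivMvPolynomial b
  have hp : MvPolynomial.map (algebraMap K L) (e f) ≠ 0 := by
    rw [map_ne_zero_iff _ (MvPolynomial.map_injective _ (algebraMap K L).injective)]
    exact (map_ne_zero_iff e e.injective).2 hf
  by_contra! hall
  refine hp (MvPolynomial.funext fun x => ?_)
  rw [map_zero, ← hall (b.constr K x), MvPolynomial.eval_map]
  change (MvPolynomial.aeval x) (e f) = _
  have : (MvPolynomial.aeval x).comp (e : _ →ₐ[K] _) = SymmetricAlgebra.lift (b.constr K x) := by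
    apply SymmetricAlgebra.algHom_ext
    refine b.ext fun i => ?_
    simp [e]
  exact DFunLike.congr_fun this f

/-- Equivariant linear maps to `L` are Zariski dense when `L^G` is infinite. -/
theorem exists_equivariant_lift_ne_zero [Finite G] {φ : G →* (L ≃ₐ[K] L)}
    (hφ : Function.Injective φ) [Infinite (fixedSubfield φ)] (τ : Representation K G W)
    {f : SymmetricAlgebra K W} (hf : f ≠ 0) :
    ∃ ψ : W →ₗ[K] L, (∀ g w, ψ (τ g w) = φ g (ψ w)) ∧ SymmetricAlgebra.lift ψ f ≠ 0 := by
  have : Infinite L := Infinite.of_injective _ (algebraMap (fixedSubfield φ) L).injective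
  obtain ⟨h, hh⟩ := exists_lift_ne_zero (L := L) hf
  obtain ⟨s, a, ψ, hψ, hsum⟩ := exists_sum_smul_equivariant hφ τ h
  -- The generic combination of the equivariant maps `ψ b`, with indeterminate coefficients. Its
  -- value `Q` at `f` is a nonzero polynomial, because it specializes at `a` to the value of `f` at
  -- `h`.
  let Ψ : W →ₗ[K] MvPolynomial L L :=
    ∑ b ∈ s, LinearMap.mulLeft K (MvPolynomial.X b) ∘ₗ
      (Algebra.linearMap L (MvPolynomial L L)).restrictScalars K ∘ₗ ψ b
  have hΨ (w : W) : Ψ w = ∑ b ∈ s, MvPolynomial.X b * MvPolynomial.C (ψ b w) := by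
    simp [Ψ, MvPolynomial.algebraMap_eq]
  let Q := SymmetricAlgebra.lift Ψ f
  have heval (x : L → L) : MvPolynomial.eval x Q =
      SymmetricAlgebra.lift (∑ b ∈ s, LinearMap.mulLeft K (x b) ∘ₗ ψ b) f := by
    have : ((MvPolynomial.aeval x : MvPolynomial L L →ₐ[L] L).restrictScalars K).comp
        (SymmetricAlgebra.lift Ψ) =
        SymmetricAlgebra.lift (∑ b ∈ s, LinearMap.mulLeft K (x b) ∘ₗ ψ b) := by
      apply SymmetricAlgebra.algHom_ext
      ext w
      simp [hΨ]
    exact DFunLike.congr_fun this f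
  have hQ : Q ≠ 0 := by
    intro h0
    apply hh
    have := heval a
    rw [h0, map_zero] at this
    rw [this]
    congr 2
    ext w
    simp [hsum]
  have hinf : (fixedSubfield φ : Set L).Infinite := Set.infinite_coe_iff.1 ‹_›
  by_contra! hall
  -- `Q` is nonzero at some point with coordinates in the infinite field `L^G`; such coefficients
  -- keep the combination equivariant.
  refine hQ (MvPolynomial.funext_set (fun _ => (fixedSubfield φ : Set L)) (fun _ => hinf)
    fun x hx => ?_)
  rw [map_zero, heval]
  refine hall _ fun g w => ?_
  simp only [LinearMap.sum_apply, LinearMap.comp_apply, LinearMap.mulLeft_apply, map_sum, map_mul,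
    hψ]
  refine Finset.sum_congr rfl fun b _ => ?_
  rw [mem_fixedSubfield.1 (hx b trivial) g]

end Equivariant

/-! ### Specialization of stable subfields -/

section Specialization

variable {K A Q L : Type*} [Field K] [CommRing A] [IsDomain A] [Algebra K A] [Field Q]
  [Algebra A Q] [IsFractionRing A Q] [Field L] [Algebra K L]

/-- The elements of `A` at which a homomorphism from `A` to a field does not vanish. -/
def nonvanishing (ψ : A →ₐ[K] L) : Submonoid A where
  carrier := {s | ψ s ≠ 0}
  one_mem' := by simp
  mul_mem' {a b} ha hb := by
    change ψ (a * b) ≠ 0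
    rw [map_mul]
    exact mul_ne_zero ha hb

theorem nonvanishing_le_nonZeroDivisors (ψ : A →ₐ[K] L) :
    nonvanishing ψ ≤ nonZeroDivisors A :=
  le_nonZeroDivisors_of_noZeroDivisors fun h => h (map_zero ψ)

variable (Q) in
/-- The domain of definition in the fraction field of `A` of a homomorphism from `A` to a field. -/
noncomputable def definedAt (ψ : A →ₐ[K] L) : Subalgebra A Q :=
  Localization.subalgebra.ofField Q (nonvanishing ψ) (nonvanishing_le_nonZeroDivisors ψ)

theorem mem_definedAt {ψ : A →ₐ[K] L} {x : Q} :
    x ∈ definedAt Q ψ ↔ ∃ a s : A, ψ s ≠ 0 ∧ x = algebraMap A Q a * (algebraMap A Q s)⁻¹ := by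
  change (∃ (a s : A) (_ : s ∈ nonvanishing ψ), x = algebraMap A Q a * (algebraMap A Q s)⁻¹) ↔ _
  exact ⟨fun ⟨a, s, hs, h⟩ => ⟨a, s, hs, h⟩, fun ⟨a, s, hs, h⟩ => ⟨a, s, hs, h⟩⟩

instance isLocalization_definedAt (ψ : A →ₐ[K] L) :
    IsLocalization (nonvanishing ψ) (definedAt Q ψ) :=
  Localization.subalgebra.isLocalization_ofField _ _ _

/-- Finitely many fractions are defined wherever a common denominator does not vanish. -/
theorem exists_forall_mem_definedAt (s : Finset Q) :
    ∃ f : A, f ≠ 0 ∧ ∀ (L : Type*) [Field L] [Algebra K L] (ψ : A →ₐ[K] L), ψ f ≠ 0 →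
      ∀ x ∈ s, x ∈ definedAt Q ψ := by
  obtain ⟨f, hf⟩ := IsLocalization.exist_integer_multiples_of_finset (nonZeroDivisors A) s
  have hf0 : (f : A) ≠ 0 := nonZeroDivisors.coe_ne_zero f
  refine ⟨f, hf0, fun L _ _ ψ hψ x hx => ?_⟩
  obtain ⟨a, ha⟩ := hf x hx
  refine mem_definedAt.2 ⟨a, f, hψ, ?_⟩
  rw [ha, Algebra.smul_def, mul_comm, inv_mul_cancel_left₀]
  rwa [map_ne_zero_iff _ (IsFractionRing.injective A Q)]

variable [Algebra K Q] [IsScalarTower K A Q]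

variable (Q) in
/-- The extension of a homomorphism from `A` to a field to its domain of definition. -/
noncomputable def specialize (ψ : A →ₐ[K] L) : (definedAt Q ψ).restrictScalars K →ₐ[K] L :=
  { (IsLocalization.lift (M := (nonvanishing ψ)) (S := definedAt Q ψ)
      (g := (ψ : A →+* L)) fun s => IsUnit.mk0 _ s.2 : definedAt Q ψ →+* L) with
    commutes' := fun c => by
      have h : algebraMap K ((definedAt Q ψ).restrictScalars K) c =
          algebraMap A (definedAt Q ψ) (algebraMap K A c) :=
        Subtype.ext (IsScalarTower.algebraMap_apply K A Q c)
      rw [h]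
      exact (IsLocalization.lift_eq _ _).trans (ψ.commutes c) }

theorem specialize_algebraMap (ψ : A →ₐ[K] L) (a : A) (h : algebraMap A Q a ∈ definedAt Q ψ) :
    specialize Q ψ ⟨algebraMap A Q a, h⟩ = ψ a :=
  IsLocalization.lift_eq (S := definedAt Q ψ) (M := (nonvanishing ψ)) _ a

theorem specialize_eq_div (ψ : A →ₐ[K] L) {x : Q} (hx : x ∈ definedAt Q ψ) {a s : A}
    (hs : ψ s ≠ 0) (h : x = algebraMap A Q a * (algebraMap A Q s)⁻¹) :
    specialize Q ψ ⟨x, hx⟩ = ψ a / ψ s := by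
  have ha : algebraMap A Q a ∈ definedAt Q ψ := Subalgebra.algebraMap_mem _ _
  have hs' : algebraMap A Q s ∈ definedAt Q ψ := Subalgebra.algebraMap_mem _ _
  have hs0 : algebraMap A Q s ≠ 0 := by
    rw [map_ne_zero_iff _ (IsFractionRing.injective A Q)]
    rintro rfl
    exact hs (map_zero ψ)
  rw [eq_div_iff hs, ← specialize_algebraMap ψ a ha, ← specialize_algebraMap ψ s hs', ← map_mul]
  congr 1
  apply Subtype.ext
  change x * algebraMap A Q s = algebraMap A Q a
  rw [h, inv_mul_cancel_right₀ hs0]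

/-- The field generated by the image of an algebra has at most the transcendence degree of the
algebra. -/
theorem toENat_trdeg_adjoin_range_le {R : Type*} [CommRing R] [Algebra K R] (f : R →ₐ[K] L) :
    Cardinal.toENat (Algebra.trdeg K (adjoin K (f.range : Set L))) ≤
      Cardinal.toENat (Algebra.trdeg K R) := by
  have h1 : Algebra.trdeg K (adjoin K (f.range : Set L)) = Algebra.trdeg K f.range := by
    have h2 : Algebra.adjoin K (f.range : Set L) = f.range := Algebra.adjoin_eq _
    -- The generated field is the fraction field of the image, hence algebraic over it.
    rw [← congrArg (fun S : Subalgebra K L => Algebra.trdeg K S) h2]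
    open scoped algebraAdjoinAdjoin in
    rw [← trdeg_add_eq K (Algebra.adjoin K (f.range : Set L))
      (A := adjoin K (f.range : Set L)), trdeg_eq_zero
      (R := Algebra.adjoin K (f.range : Set L)), add_zero]
  rw [h1]
  have := OrderHomClass.mono Cardinal.toENat
    (lift_trdeg_le_of_surjective f.rangeRestrict f.rangeRestrict_surjective)
  simpa using this

variable {G : Type*} [Group G]

/-- A `G`-equivariant specialization `A → L` that is defined at enough elements of a `G`-stable
subfield `F` of the fraction field of `A` bounds `ed_K(L / L^G)` by the transcendence degree
of `F`. -/
theorem essDim_le_of_specialization [Finite G] {φ : G →* (L ≃ₐ[K] L)}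
    (hφ : Function.Injective φ) (α : G →* (Q ≃ₐ[K] Q)) (β : G →* (A ≃ₐ[K] A))
    (hαβ : ∀ g a, α g (algebraMap A Q a) = algebraMap A Q (β g a)) (ψ : A →ₐ[K] L)
    (hψ : ∀ g a, ψ (β g a) = φ g (ψ a)) (F : IntermediateField K Q)
    (hF : ∀ g, ∀ x ∈ F, α g x ∈ F)
    (hfaith : ∀ g : G, g ≠ 1 → ∃ y ∈ F, α g y ≠ y ∧ y ∈ definedAt Q ψ ∧
      (α g y - y)⁻¹ ∈ definedAt Q ψ) :
    essDim (fixedSubfield φ) ≤ Cardinal.toENat (Algebra.trdeg K F) := by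
  have hequiv (g : G) (x : Q) (hx : x ∈ definedAt Q ψ) : ∃ h : α g x ∈ definedAt Q ψ,
      specialize Q ψ ⟨α g x, h⟩ = φ g (specialize Q ψ ⟨x, hx⟩) := by
    obtain ⟨a, s, hs, h⟩ := mem_definedAt.1 hx
    have hs' : ψ (β g s) ≠ 0 := by
      rw [hψ]
      exact (map_ne_zero_iff _ (φ g).injective).2 hs
    have h' : α g x = algebraMap A Q (β g a) * (algebraMap A Q (β g s))⁻¹ := by
      rw [h, map_mul, map_inv₀, hαβ, hαβ]
    refine ⟨mem_definedAt.2 ⟨_, _, hs', h'⟩, ?_⟩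
    rw [specialize_eq_div ψ _ hs' h', specialize_eq_div ψ hx hs h, map_div₀, hψ, hψ]
  -- The elements of `F` where `ψ` is defined. The field generated by their image in `L` is the
  -- required stable subfield.
  let R : Subalgebra K Q := (definedAt Q ψ).restrictScalars K ⊓ F.toSubalgebra
  let Ψ : R →ₐ[K] L := (specialize Q ψ).comp (Subalgebra.inclusion inf_le_left)
  have hΨ (x : Q) (hx : x ∈ R) : Ψ ⟨x, hx⟩ = specialize Q ψ ⟨x, hx.1⟩ := rfl
  have hR (g : G) (x : Q) (hx : x ∈ R) :
      ∃ h : α g x ∈ R, Ψ ⟨α g x, h⟩ = φ g (Ψ ⟨x, hx⟩) := by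
    obtain ⟨h, h'⟩ := hequiv g x hx.1
    exact ⟨⟨h, hF g x hx.2⟩, h'⟩
  refine (essDim_le_trdeg_of_stable hφ (adjoin K (Ψ.range : Set L)) ?_ ?_).trans
    ((toENat_trdeg_adjoin_range_le Ψ).trans (OrderHomClass.mono _
      (trdeg_le_of_injective (Subalgebra.inclusion (inf_le_right : R ≤ F.toSubalgebra))
        (Subalgebra.inclusion_injective _))))
  · intro g
    change adjoin K (Ψ.range : Set L) ≤
      (adjoin K (Ψ.range : Set L)).comap (φ g : L →ₐ[K] L)
    rw [adjoin_le_iff]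
    rintro _ ⟨⟨x, hx⟩, rfl⟩
    obtain ⟨h, h'⟩ := hR g x hx
    exact subset_adjoin K _ ⟨⟨α g x, h⟩, h'⟩
  · intro g hg
    by_contra hne
    obtain ⟨y, hyF, hy, hyB, hzB⟩ := hfaith g hne
    have hyR : y ∈ R := ⟨hyB, hyF⟩
    obtain ⟨h, h'⟩ := hR g y hyR
    have hfix := hg (Ψ ⟨y, hyR⟩) (subset_adjoin K _ ⟨_, rfl⟩)
    have hzR : (α g y - y)⁻¹ ∈ R := ⟨hzB, F.inv_mem (F.sub_mem h.2 hyF)⟩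
    -- If `g` fixed the image pointwise, the unit `α g y - y` of `R` would map to `0`.
    have h0 : Ψ (⟨α g y, h⟩ - ⟨y, hyR⟩) = 0 := by rw [map_sub, h', hfix, sub_self]
    have h1 : (⟨α g y, h⟩ - ⟨y, hyR⟩) * (⟨_, hzR⟩ : R) = 1 :=
      Subtype.ext (mul_inv_cancel₀ (sub_ne_zero.2 hy))
    have := congrArg Ψ h1
    rw [map_mul, h0, zero_mul, map_one] at this
    exact zero_ne_one this

end Specialization

/-! ### Faithfulness of the action on the function field -/

section Representations

variable {K G V : Type*} [Field K] [Group G] [AddCommGroup V] [Module K V]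

theorem functionFieldAction_algebraMap (ρ : Representation K G V) (g : G)
    (a : CoordinateRing K V) :
    functionFieldAction ρ g (algebraMap (CoordinateRing K V) (FunctionField K V) a) =
      algebraMap (CoordinateRing K V) (FunctionField K V) (coordinateAction ρ g a) :=
  IsFractionRing.fieldEquivOfAlgEquiv_algebraMap _ _ _ _ _

theorem symmetricAlgebra_ι_injective (R M : Type*) [CommRing R] [AddCommGroup M] [Module R M]
    [Module.Free R M] : Function.Injective (SymmetricAlgebra.ι R M) := by
  let b := Module.Free.chooseBasis R M
  have h : (SymmetricAlgebra.equivMvPolynomial b).toLinearMap ∘ₗ SymmetricAlgebra.ι R M =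
      b.constr R MvPolynomial.X := b.ext fun i => by simp
  have hinj : Function.Injective (b.constr R (MvPolynomial.X : _ → MvPolynomial _ R)) :=
    b.injective_constr_of_linearIndependent (MvPolynomial.linearIndependent_X _ _)
  rw [← h, LinearMap.coe_comp] at hinj
  exact hinj.of_comp

theorem functionFieldAction_injective {ρ : Representation K G V} (hρ : Function.Injective ρ) :
    Function.Injective (functionFieldAction ρ) := by
  rw [injective_iff_map_eq_one]
  intro g hg
  have h1 (f : Module.Dual K V) : ρ.dual g f = f := by
    apply symmetricAlgebra_ι_injective K (Module.Dual K V)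
    apply IsFractionRing.injective (CoordinateRing K V) (FunctionField K V)
    have := functionFieldAction_algebraMap ρ g (SymmetricAlgebra.ι K _ f)
    rw [hg, AlgEquiv.one_apply] at this
    rw [this]
    congr 1
    exact (coordinateMap_ι ρ g f).symm
  rw [← inv_eq_one]
  apply hρ
  rw [map_one]
  ext v
  rw [← sub_eq_zero, ← Module.forall_dual_apply_eq_zero_iff K]
  intro f
  rw [map_sub, sub_eq_zero]
  exact LinearMap.congr_fun (h1 f) v

end Representations

end EssentialDimension

theorem proposition2p8 {K L G V : Type*} [Field K] [Field L] [Algebra K L] [Group G] [Finite G]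
    (φ : G →* (L ≃ₐ[K] L)) (hφ : Function.Injective φ)
    [AddCommGroup V] [Module K V] [FiniteDimensional K V]
    (ρ : Representation K G V) (hρ : Function.Injective ρ) :
    EssentialDimension.essDim (EssentialDimension.fixedSubfield φ) ≤
      EssentialDimension.essDimGroup ρ := by
  open EssentialDimension in
  classical
  have := Fintype.ofFinite G
  cases finite_or_infinite (fixedSubfield φ)
  · rw [essDim_eq_zero_of_finite hφ]
    exact zero_le
  refine le_sInf ?_
  rintro _ ⟨E, E₀, hE, rfl⟩
  obtain ⟨F, hF, hfaith, htrdeg⟩ :=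
    exists_stable_of_isDefinedOver (functionFieldAction_injective hρ) hE
  rw [← htrdeg]
  -- The value at `g = 1` is a dummy, so that `y` is a function on all of `G`.
  have hex (g : G) : ∃ y ∈ F, g ≠ 1 → functionFieldAction ρ g y ≠ y := by
    by_cases hg : g = 1
    · exact ⟨0, F.zero_mem, fun h => absurd hg h⟩
    · by_contra! h
      exact hg (hfaith g fun x hx => (h x hx).2)
  choose y hyF hy using hex
  obtain ⟨f, hf0, hf⟩ := exists_forall_mem_definedAt (K := K) (A := CoordinateRing K V)
    (Finset.univ.image y ∪
      Finset.univ.image fun g => (functionFieldAction ρ g (y g) - y g)⁻¹)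
  obtain ⟨ψ, hψ, hψf⟩ := exists_equivariant_lift_ne_zero hφ ρ.dual hf0
  refine essDim_le_of_specialization hφ (functionFieldAction ρ) (coordinateAction ρ)
    (functionFieldAction_algebraMap ρ) (SymmetricAlgebra.lift ψ) (fun g a => ?_) F hF
    fun g hg => ⟨y g, hyF g, hy g hg, ?_, ?_⟩
  · have : (SymmetricAlgebra.lift ψ).comp (coordinateMap ρ g) =
        (φ g : L →ₐ[K] L).comp (SymmetricAlgebra.lift ψ) := by
      apply SymmetricAlgebra.algHom_ext
      refine LinearMap.ext fun w => ?_
      change SymmetricAlgebra.lift ψ (coordinateMap ρ g (SymmetricAlgebra.ι K _ w)) =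
        φ g (SymmetricAlgebra.lift ψ (SymmetricAlgebra.ι K _ w))
      rw [coordinateMap_ι, SymmetricAlgebra.lift_ι_apply, SymmetricAlgebra.lift_ι_apply, hψ]
    exact DFunLike.congr_fun this a
  · exact hf L _ hψf _ (Finset.mem_union_left _ (Finset.mem_image_of_mem _ (Finset.mem_univ g)))
  · exact hf L _ hψf _ (Finset.mem_union_right _
      (Finset.mem_image_of_mem (fun g => (functionFieldAction ρ g (y g) - y g)⁻¹)
        (Finset.mem_univ g)))
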